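/- For $N\ge 1$ let $S^{N-1}(\sqrt N)\subset\mathbb R^N$ be the sphere of radius $\sqrt N$ centred at the origin, let $\sigma^N$ be the uniform probability measure on it, and let $\gamma(v)=(2\pi)^{-1/2}e^{-v^2/2}$, identified with the standard Gaussian measure on $\mathbb R$. For probability measures $\mu,\nu$ on a measurable space, let $H(\mu|\nu)=\int h\log h\,d\nu\in[0,+\infty]$ if $\mu\ll\nu$ with $h=d\mu/d\nu$, and $H(\mu|\nu)=+\infty$ otherwise. For a probability density $f$ on $\mathbb R$ write $H(f|\gamma)=H(f\,dv|\gamma)=\int_{\mathbb R} f\log(f/\gamma)\,dv$. Let $\mu$ be a Borel probability measure on $\mathbb R$. A sequence $(\mu^{(N)})_{N\ge1}$ of probability measures, $\mu^{(N)}$ on $S^{N-1}(\sqrt N)$, is called entropically $\mu$-chaotic if (i) each $\mu^{(N)}$ is invariant under permutations of the variables $v_1,\dots,v_N$; (ii) for every integer $k\ge1$ and every bounded continuous $\chi:\mathbb R^k\to\mathbb R$, $$\int \chi(v_1,\dots,v_k)\,d\mu^{(N)}(v_1,\dots,v_N)\ \longrightarrow\ \int_{\mathbb R^k}\chi\,d\mu^{\otimes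 k}\qquad (N\to\infty);$$ (iii) $\displaystyle \lim_{N\to\infty}\frac{H(\mu^{(N)}|\sigma^N)}{N}=H(\mu|\gamma)$. **Theorem.** Let $f$ be a probability density on $\mathbb R$ with $$\int_{\mathbb R} f(v)\,v^2\,dv=1\qquad\text{and}\qquad H(f|\gamma)<+\infty .$$ Then there exists an entropically $f(v)\,dv$-chaotic sequence $(\mu^{(N)})_{N\ge1}$ of probability measures on the spheres $S^{N-1}(\sqrt N)$. -/

import Mathlib

open MeasureTheory Filter
open scoped Topology BoundedContinuousFunction ENNReal

noncomputable section

namespace KacChaos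

/-- The sphere `S^{N-1}(√N)` of radius `√N` in `ℝ^N`. -/
abbrev KacSphere (N : ℕ) : Type :=
  Metric.sphere (0 : EuclideanSpace ℝ (Fin N)) (Real.sqrt N)

/-- The dilation `x ↦ √N x` from the unit sphere of `ℝ^N` onto `S^{N-1}(√N)`. -/
def dilate (N : ℕ) (x : Metric.sphere (0 : EuclideanSpace ℝ (Fin N)) 1) : KacSphere N :=
  ⟨Real.sqrt N • (x : EuclideanSpace ℝ (Fin N)), by
    have hx : ‖(x : EuclideanSpace ℝ (Fin N))‖ = 1 := by simp
    rw [mem_sphere_zero_iff_norm, norm_smul, hx, mul_one, Real.norm_eq_abs,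
      abs_of_nonneg (Real.sqrt_nonneg _)]⟩

/-- The surface measure of the unit sphere of `ℝ^N`. -/
def unitSurface (N : ℕ) : Measure (Metric.sphere (0 : EuclideanSpace ℝ (Fin N)) 1) :=
  (volume : Measure (EuclideanSpace ℝ (Fin N))).toSphere

/-- The uniform probability measure `σ^N` on `S^{N-1}(√N)` (for `1 ≤ N`): the normalized surface
measure of the unit sphere, transported by the dilation of ratio `√N`. -/
def uniformMeasure (N : ℕ) : Measure (KacSphere N) :=
  ((unitSurface N Set.univ)⁻¹ • unitSurface N).map (dilate N)

/-- The action of a permutation of the coordinates `v_1, …, v_N` on `S^{N-1}(√N)`. -/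
def permute {N : ℕ} (π : Equiv.Perm (Fin N)) (x : KacSphere N) : KacSphere N :=
  ⟨LinearIsometryEquiv.piLpCongrLeft 2 ℝ ℝ π (x : EuclideanSpace ℝ (Fin N)), by
    have hx : ‖(x : EuclideanSpace ℝ (Fin N))‖ = Real.sqrt N := by simp
    rw [mem_sphere_zero_iff_norm, LinearIsometryEquiv.norm_map, hx]⟩

/-- The projection `(v_1, …, v_N) ↦ (v_1, …, v_k)`. It is only meaningful for `k ≤ N`; missing
coordinates are filled up by `0`. -/
def firstCoords (k N : ℕ) (x : KacSphere N) : Fin k → ℝ :=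
  fun i => if h : (i : ℕ) < N then (x : EuclideanSpace ℝ (Fin N)) ⟨i, h⟩ else 0

/-- The marginal `P_k ν` for the first `k` velocities of a measure `ν` on `S^{N-1}(√N)`. -/
def marginal (k : ℕ) {N : ℕ} (ν : Measure (KacSphere N)) : Measure (Fin k → ℝ) :=
  ν.map (firstCoords k N)

/-- Let `μ` be a probability measure on `ℝ`. The sequence `(μN N)`, `N = 1, 2, …`, of probability
measures on the spheres `S^{N-1}(√N)` is `μ`-chaotic. (The value at `N = 0` plays no role.) -/
structure IsChaotic (μ : Measure ℝ) (μN : (N : ℕ) → Measure (KacSphere N)) : Prop where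
  isProbabilityMeasure : ∀ N : ℕ, 0 < N → IsProbabilityMeasure (μN N)
  symmetric : ∀ N : ℕ, 0 < N → ∀ π : Equiv.Perm (Fin N), (μN N).map (permute π) = μN N
  tendsto_marginal : ∀ k : ℕ, 0 < k → ∀ χ : (Fin k → ℝ) →ᵇ ℝ,
    Tendsto (fun N : ℕ => ∫ v, χ v ∂(marginal k (μN N))) atTop
      (𝓝 (∫ v, χ v ∂(Measure.pi (fun _ : Fin k => μ))))

/-- The sequence `(μN N)` is entropically `μ`-chaotic: it is `μ`-chaotic and
`H(μN N | σ^N) / N → H(μ | γ)`, with `γ` the standard Gaussian measure on `ℝ`. The relative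
entropies take their values in `[0, ∞]`. -/
structure IsEntropicallyChaotic (μ : Measure ℝ) (μN : (N : ℕ) → Measure (KacSphere N)) : Prop
    extends IsChaotic μ μN where
  tendsto_entropy :
    Tendsto (fun N : ℕ => InformationTheory.klDiv (μN N) (uniformMeasure N) / (N : ℝ≥0∞)) atTop
      (𝓝 (InformationTheory.klDiv μ (ProbabilityTheory.gaussianReal 0 1)))

/-- The measure `f(v) dv` on `ℝ`. -/
def densityMeasure (f : ℝ → ℝ) : Measure ℝ :=
  (volume : Measure ℝ).withDensity (fun v => ENNReal.ofReal (f v))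

end KacChaos

end

/-! The sequence is the simplest candidate: `μ^{(N)}` is the law of `√N X/|X|`, where `X` has `N`
independent coordinates of law `μ = f dv`. Symmetry is immediate. Since `μ` has second moment 1, the
law of large numbers gives `√N/|X| → 1` almost surely, so the projection barely moves the first `k`
coordinates and chaos follows.

Upper entropy bound: the same projection sends the standard Gaussian on `ℝ^N` to `σ^N`. Relative
entropy decreases under maps and is subadditive on products, so `H(μ^{(N)}|σ^N) ≤ N H(μ|γ)` for
every `N ≥ 1` (`klDiv_projectedPi_le`).

Lower entropy bound: test the Donsker-Varadhan inequality with `∑ φ(v_i)`, where `φ` is continuous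
with compact support and nearly optimal for `H(μ|γ)`. The linear term is controlled by chaos. The
exponential moment under `σ^N` is at most `2 (e^ε ∫ e^φ dγ)^N`
(`eventually_integral_exp_sum_uniformMeasure_le`): the direction of a Gaussian vector is independent
of its norm, so one may restrict to norms close to `√N`, where the projection is a dilation of ratio
near 1. No local limit theorem or regularity of `f` is needed. -/

namespace KacChaos

open InformationTheory ProbabilityTheory

/-! ### Relative entropy -/

section Entropy

variable {α β : Type*} [MeasurableSpace α] [MeasurableSpace β]

/-- The Donsker-Varadhan inequality. -/
theorem integral_sub_log_integral_exp_le_klDiv (μ ν : Measure α) [IsProbabilityMeasure μ]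
    [IsProbabilityMeasure ν] {φ : α → ℝ} (hφ : Integrable φ μ)
    (hexp : Integrable (fun x => Real.exp (φ x)) ν) :
    ENNReal.ofReal (∫ x, φ x ∂μ - Real.log (∫ x, Real.exp (φ x) ∂ν)) ≤ klDiv μ ν := by
  by_cases h : klDiv μ ν = ∞
  · simp [h]
  obtain ⟨hac, hint⟩ := klDiv_ne_top_iff.1 h
  have := isProbabilityMeasure_tilted hexp
  -- The inequality is the nonnegativity of the entropy of `μ` relative to `ν` tilted by `φ`.
  have h0 := integral_llr_add_sub_measure_univ_nonneg
    (hac.trans (absolutelyContinuous_tilted hexp)) (integrable_llr_tilted_right hac hφ hint hexp)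
  rw [integral_llr_tilted_right hac hφ hexp hint] at h0
  rw [klDiv_of_ac_of_integrable hac hint]
  apply ENNReal.ofReal_le_ofReal
  simp only [probReal_univ] at h0 ⊢
  linarith

/-- Chain rule for constant kernels; the swap puts the common factor `μ` in the kernel position,
where it cancels. -/
theorem klDiv_prod_le (μ ν : Measure α) (μ' ν' : Measure β) [IsProbabilityMeasure μ]
    [IsProbabilityMeasure ν] [IsProbabilityMeasure μ'] [IsProbabilityMeasure ν'] :
    klDiv (μ.prod μ') (ν.prod ν') ≤ klDiv μ ν + klDiv μ' ν' := by
  rw [← Measure.compProd_const, ← Measure.compProd_const, klDiv_compProd_eq_add]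
  gcongr
  rw [Measure.compProd_const, Measure.compProd_const, ← Measure.prod_swap (μ := μ') (ν := μ),
    ← Measure.prod_swap (μ := ν') (ν := μ)]
  refine (klDiv_map_le _ _ measurable_swap).trans ?_
  rw [← Measure.compProd_const, ← Measure.compProd_const, klDiv_compProd_left]

theorem klDiv_pi_le (μ ν : Measure α) [IsProbabilityMeasure μ] [IsProbabilityMeasure ν] (n : ℕ) :
    klDiv (Measure.pi fun _ : Fin n => μ) (Measure.pi fun _ : Fin n => ν) ≤ n * klDiv μ ν := by
  induction n with
  | zero =>
    have h : (Measure.pi fun _ : Fin 0 => μ) = Measure.pi fun _ : Fin 0 => ν := by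
      rw [Measure.pi_of_empty, Measure.pi_of_empty]
    rw [h, klDiv_self]
    simp
  | succ n ih =>
    rw [← ((measurePreserving_piFinSuccAbove (fun _ : Fin (n + 1) => μ) 0).symm).map_eq,
      ← ((measurePreserving_piFinSuccAbove (fun _ : Fin (n + 1) => ν) 0).symm).map_eq]
    refine (klDiv_map_le _ _ (MeasurableEquiv.measurable _)).trans ?_
    refine (klDiv_prod_le _ _ _ _).trans ?_
    push_cast
    rw [add_mul, one_mul, add_comm]
    gcongr

/-- Up to an arbitrarily small error, the supremum in the Donsker-Varadhan formula is attained on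
bounded measurable functions. -/
theorem exists_bounded_lt_integral_sub_log (μ ν : Measure α) [IsProbabilityMeasure μ]
    [IsProbabilityMeasure ν] (h : klDiv μ ν ≠ ∞) {c : ℝ} (hc : c < (klDiv μ ν).toReal) :
    ∃ (φ : α → ℝ) (M : ℝ), 0 ≤ M ∧ Measurable φ ∧ (∀ x, |φ x| ≤ M) ∧
      c < ∫ x, φ x ∂μ - Real.log (∫ x, Real.exp (φ x) ∂ν) := by
  obtain ⟨hac, hint⟩ := klDiv_ne_top_iff.1 h
  rw [toReal_klDiv_of_measure_eq hac (by simp)] at hc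
  set ρ : α → ℝ := fun x => (μ.rnDeriv ν x).toReal with hρ
  have hρm : Measurable ρ := (Measure.measurable_rnDeriv μ ν).ennreal_toReal
  have hρpos : ∀ᵐ x ∂μ, 0 < ρ x := by
    filter_upwards [Measure.rnDeriv_pos hac, hac.ae_le (Measure.rnDeriv_lt_top μ ν)] with x h1 h2
    exact ENNReal.toReal_pos h1.ne' h2.ne
  have hρ0 : ∀ x, 0 ≤ ρ x := fun x => ENNReal.toReal_nonneg
  -- The optimal test function is `log ρ`; truncating `ρ` makes it bounded. The positive lower level
  -- also handles `ρ = 0`, which `ν` may charge and where `Real.log` has the default value 0.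
  set k : ℕ → α → ℝ := fun n x => max (Real.exp (-(n : ℝ))) (min (Real.exp n) (ρ x)) with hk
  have hkpos : ∀ (n : ℕ) x, 0 < k n x := fun n x => lt_max_of_lt_left (Real.exp_pos _)
  have hkm : ∀ n, Measurable (k n) := fun n =>
    measurable_const.max (measurable_const.min hρm)
  have hexp : ∀ n : ℕ, Real.exp (-(n : ℝ)) ≤ 1 := fun n => by simp
  have hexp' : ∀ n : ℕ, 1 ≤ Real.exp (n : ℝ) := fun n => by simp
  have hle : ∀ (n : ℕ) x, k n x ≤ Real.exp n := fun n x =>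
    max_le ((hexp n).trans (hexp' n)) (min_le_left _ _)
  have hge : ∀ (n : ℕ) x, Real.exp (-(n : ℝ)) ≤ k n x := fun n x => le_max_left _ _
  have hbd : ∀ (n : ℕ) x, |Real.log (k n x)| ≤ n := fun n x => by
    rw [abs_le]
    constructor
    · rw [Real.le_log_iff_exp_le (hkpos n x)]; exact hge n x
    · rw [Real.log_le_iff_le_exp (hkpos n x)]; exact hle n x
  have hup : Tendsto (fun n : ℕ => Real.exp (n : ℝ)) atTop atTop :=
    Real.tendsto_exp_atTop.comp tendsto_natCast_atTop_atTop
  have hdown : Tendsto (fun n : ℕ => Real.exp (-(n : ℝ))) atTop (𝓝 0) :=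
    Real.tendsto_exp_neg_atTop_nhds_zero.comp tendsto_natCast_atTop_atTop
  have hlim : ∀ x, Tendsto (fun n => k n x) atTop (𝓝 (ρ x)) := fun x => by
    have h1 : Tendsto (fun n : ℕ => min (Real.exp (n : ℝ)) (ρ x)) atTop (𝓝 (ρ x)) := by
      refine tendsto_const_nhds.congr' ?_
      filter_upwards [hup.eventually_ge_atTop (ρ x)] with n hn
      rw [min_eq_right hn]
    have h2 := hdown.max h1
    rwa [max_eq_right (hρ0 x)] at h2
  have hL1 : Tendsto (fun n => ∫ x, Real.log (k n x) ∂μ) atTop (𝓝 (∫ x, llr μ ν x ∂μ)) := by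
    refine tendsto_integral_of_dominated_convergence (fun x => |llr μ ν x|)
      (fun n => (hkm n).log.aestronglyMeasurable) hint.abs ?_ ?_
    -- Both truncation levels lie on either side of 1, so truncation moves `ρ` towards 1 and shrinks
    -- `|log ρ|`.
    · intro n
      filter_upwards [hρpos] with x h0
      rw [Real.norm_eq_abs]
      change _ ≤ |Real.log (ρ x)|
      rcases le_total (ρ x) 1 with h1 | h1
      · have hk1 : k n x = max (Real.exp (-(n : ℝ))) (ρ x) := by
          simp only [hk, min_eq_right (h1.trans (hexp' n))]
        have hle1 : k n x ≤ 1 := by rw [hk1]; exact max_le (hexp n) h1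
        rw [abs_of_nonpos (Real.log_nonpos h0.le h1),
          abs_of_nonpos (Real.log_nonpos (hkpos n x).le hle1), neg_le_neg_iff]
        exact Real.log_le_log h0 (by rw [hk1]; exact le_max_right _ _)
      · have hk1 : k n x = min (Real.exp (n : ℝ)) (ρ x) := by
          simp only [hk]
          exact max_eq_right ((hexp n).trans (le_min (hexp' n) h1))
        have hge1 : 1 ≤ k n x := by rw [hk1]; exact le_min (hexp' n) h1
        rw [abs_of_nonneg (Real.log_nonneg h1), abs_of_nonneg (Real.log_nonneg hge1)]
        exact Real.log_le_log (hkpos n x) (by rw [hk1]; exact min_le_right _ _)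
    · filter_upwards [hρpos] with x hx
      exact (hlim x).log hx.ne'
  have hL2 : Tendsto (fun n => ∫ x, k n x ∂ν) atTop (𝓝 (∫ x, ρ x ∂ν)) := by
    refine tendsto_integral_of_dominated_convergence (fun x => 1 + ρ x)
      (fun n => (hkm n).aestronglyMeasurable)
      ((integrable_const 1).add Measure.integrable_toReal_rnDeriv) ?_
      (Eventually.of_forall hlim)
    intro n
    refine Eventually.of_forall fun x => ?_
    rw [Real.norm_eq_abs, abs_of_pos (hkpos n x)]
    exact max_le ((hexp n).trans (by linarith [hρ0 x]))
      ((min_le_right _ _).trans (by linarith))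
  rw [Measure.integral_toReal_rnDeriv hac, probReal_univ] at hL2
  have hL := hL1.sub (hL2.log one_ne_zero)
  rw [Real.log_one, sub_zero] at hL
  obtain ⟨n, hn⟩ := (hL.eventually_const_lt hc).exists
  refine ⟨fun x => Real.log (k n x), n, n.cast_nonneg, (hkm n).log, hbd n, ?_⟩
  simpa only [Real.exp_log (hkpos n _)] using hn

end Entropy

/-! ### Passage to continuous, compactly supported test functions. -/

theorem abs_clamp_sub_clamp_le (M a b : ℝ) :
    |max (-M) (min M a) - max (-M) (min M b)| ≤ |a - b| := by
  refine (abs_max_sub_max_le_max (-M) (min M a) (-M) (min M b)).trans ?_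
  rw [sub_self, abs_zero, max_eq_right (abs_nonneg _)]
  simpa using abs_min_sub_min_le_max M a M b

/-- Follows from `1 - exp (y - x) ≤ x - y`; it transfers `L¹` approximation from `φ` to `exp φ`. -/
theorem abs_exp_sub_exp_le {M a b : ℝ} (ha : |a| ≤ M) (hb : |b| ≤ M) :
    |Real.exp a - Real.exp b| ≤ Real.exp M * |a - b| := by
  have key : ∀ {x y : ℝ}, x ≤ M → y ≤ x →
      Real.exp x - Real.exp y ≤ Real.exp M * (x - y) := by
    intro x y hx hxy
    have h1 : Real.exp y = Real.exp x * Real.exp (y - x) := by rw [← Real.exp_add]; ring_nf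
    have h2 := Real.add_one_le_exp (y - x)
    have h3 := Real.exp_le_exp.2 hx
    calc Real.exp x - Real.exp y = Real.exp x * (1 - Real.exp (y - x)) := by rw [h1]; ring
      _ ≤ Real.exp x * (x - y) :=
          mul_le_mul_of_nonneg_left (by linarith) (Real.exp_pos _).le
      _ ≤ Real.exp M * (x - y) := mul_le_mul_of_nonneg_right h3 (by linarith)
  rcases le_total b a with h | h
  · rw [abs_of_nonneg (sub_nonneg.2 h), abs_of_nonneg (sub_nonneg.2 (Real.exp_le_exp.2 h))]
    exact key (abs_le.1 ha).2 h
  · rw [abs_sub_comm, abs_sub_comm a b, abs_of_nonneg (sub_nonneg.2 h),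
      abs_of_nonneg (sub_nonneg.2 (Real.exp_le_exp.2 h))]
    exact key (abs_le.1 hb).2 h

/-- Up to an arbitrarily small error, the supremum in the Donsker-Varadhan formula on `ℝ` is
attained on compactly supported continuous functions. -/
theorem exists_hasCompactSupport_lt_integral_sub_log (μ ν : Measure ℝ) [IsProbabilityMeasure μ]
    [IsProbabilityMeasure ν] (h : klDiv μ ν ≠ ∞) {c : ℝ} (hc : c < (klDiv μ ν).toReal) :
    ∃ φ : ℝ → ℝ, Continuous φ ∧ HasCompactSupport φ ∧
      c < ∫ x, φ x ∂μ - Real.log (∫ x, Real.exp (φ x) ∂ν) := by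
  obtain ⟨φ, M, hM, hφm, hφM, hφ⟩ := exists_bounded_lt_integral_sub_log μ ν h hc
  have hint : ∀ (ψ : ℝ → ℝ), Measurable ψ → (∀ x, |ψ x| ≤ M) →
      ∀ (κ : Measure ℝ) [IsFiniteMeasure κ], Integrable ψ κ := fun ψ h1 h2 κ _ =>
    Integrable.of_bound h1.aestronglyMeasurable M (Eventually.of_forall h2)
  have hinte : ∀ (ψ : ℝ → ℝ), Measurable ψ → (∀ x, |ψ x| ≤ M) →
      ∀ (κ : Measure ℝ) [IsFiniteMeasure κ], Integrable (fun x => Real.exp (ψ x)) κ :=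
    fun ψ h1 h2 κ _ => Integrable.of_bound h1.exp.aestronglyMeasurable (Real.exp M)
      (Eventually.of_forall fun x => by
        rw [Real.norm_eq_abs, Real.abs_exp]
        exact Real.exp_le_exp.2 (abs_le.1 (h2 x)).2)
  have happ : ∀ n : ℕ, ∃ g : ℝ → ℝ, Continuous g ∧ HasCompactSupport g ∧ (∀ x, |g x| ≤ M) ∧
      (∫ x, |φ x - g x| ∂(μ + ν)) ≤ 1 / ((n : ℝ) + 1) := by
    intro n
    -- Approximating in `L¹(μ + ν)` serves both integrals at once. Clamping to `[-M, M]` fixes 0,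
    -- hence keeps the support compact, and does not increase the error.
    obtain ⟨g, hg1, hg2, hg3, hg4⟩ := (hint φ hφm hφM (μ + ν)).exists_hasCompactSupport_integral_sub_le
      (Nat.one_div_pos_of_nat (α := ℝ) (n := n))
    refine ⟨fun x => max (-M) (min M (g x)), by fun_prop, ?_, ?_, ?_⟩
    · refine hg1.comp_left (g := fun y : ℝ => max (-M) (min M y)) ?_
      simp [hM]
    · intro x
      rw [abs_le]
      exact ⟨le_max_left _ _, max_le (by linarith) (min_le_left _ _)⟩
    · refine le_trans ?_ hg2
      have hφx : ∀ x, φ x = max (-M) (min M (φ x)) := fun x => by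
        rw [min_eq_right (abs_le.1 (hφM x)).2, max_eq_right (abs_le.1 (hφM x)).1]
      refine integral_mono_of_nonneg (Eventually.of_forall fun x => abs_nonneg _)
        ((hint φ hφm hφM (μ + ν)).sub hg4).norm (Eventually.of_forall fun x => ?_)
      simp only [Real.norm_eq_abs]
      conv_lhs => rw [hφx x]
      exact abs_clamp_sub_clamp_le M _ _
  choose g hg1 hg2 hg3 hg4 using happ
  have habs : ∀ n (κ : Measure ℝ) [IsFiniteMeasure κ], Integrable (fun x => |φ x - g n x|) κ :=
    fun n κ _ => ((hint φ hφm hφM κ).sub (hint _ (hg1 n).measurable (hg3 n) κ)).abs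
  have hsum : ∀ n, ∫ x, |φ x - g n x| ∂μ + ∫ x, |φ x - g n x| ∂ν ≤ 1 / ((n : ℝ) + 1) := fun n => by
    rw [← integral_add_measure (habs n μ) (habs n ν)]
    exact hg4 n
  have hn1 : ∀ n (κ : Measure ℝ), 0 ≤ ∫ x, |φ x - g n x| ∂κ :=
    fun n κ => integral_nonneg fun x => abs_nonneg _
  have hz := tendsto_one_div_add_atTop_nhds_zero_nat (𝕜 := ℝ)
  have hL1 : Tendsto (fun n => ∫ x, g n x ∂μ) atTop (𝓝 (∫ x, φ x ∂μ)) := by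
    refine tendsto_iff_norm_sub_tendsto_zero.2 (squeeze_zero (fun _ => norm_nonneg _) (fun n => ?_) hz)
    rw [← integral_sub (hint _ (hg1 n).measurable (hg3 n) μ) (hint φ hφm hφM μ)]
    refine (norm_integral_le_integral_norm _).trans ?_
    simp only [Real.norm_eq_abs, abs_sub_comm (g n _)]
    linarith [hsum n, hn1 n ν]
  have hL2 : Tendsto (fun n => ∫ x, Real.exp (g n x) ∂ν) atTop (𝓝 (∫ x, Real.exp (φ x) ∂ν)) := by
    have hz' := hz.const_mul (Real.exp M)
    rw [mul_zero] at hz'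
    refine tendsto_iff_norm_sub_tendsto_zero.2
      (squeeze_zero (fun _ => norm_nonneg _) (fun n => ?_) hz')
    rw [← integral_sub (hinte _ (hg1 n).measurable (hg3 n) ν) (hinte φ hφm hφM ν)]
    refine (norm_integral_le_integral_norm _).trans ?_
    calc ∫ x, ‖Real.exp (g n x) - Real.exp (φ x)‖ ∂ν
        ≤ ∫ x, Real.exp M * |φ x - g n x| ∂ν := by
          refine integral_mono_of_nonneg (Eventually.of_forall fun x => norm_nonneg _)
            ((habs n ν).const_mul _) (Eventually.of_forall fun x => ?_)
          simp only [Real.norm_eq_abs]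
          rw [abs_sub_comm (φ x)]
          exact abs_exp_sub_exp_le (hg3 n x) (hφM x)
      _ = Real.exp M * ∫ x, |φ x - g n x| ∂ν := integral_const_mul _ _
      _ ≤ _ := by
          gcongr
          linarith [hsum n, hn1 n μ]
  have hL := hL1.sub (hL2.log (integral_exp_pos (hinte φ hφm hφM ν)).ne')
  obtain ⟨n, hn⟩ := (hL.eventually_const_lt hφ).exists
  exact ⟨g n, hg1 n, hg2 n, hn⟩

/-! ### The radial projection onto the sphere -/

section Radial

/-- The Euclidean norm of a vector of `Fin N → ℝ`. -/
noncomputable def euclideanNorm {N : ℕ} (x : Fin N → ℝ) : ℝ := ‖WithLp.toLp 2 x‖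

/-- The radial projection `x ↦ √N x / |x|` of `ℝ^N` onto `S^{N-1}(√N)`; the origin is sent to
`(1, …, 1)`. -/
noncomputable def radial (N : ℕ) (x : Fin N → ℝ) : KacSphere N :=
  if h : x = 0 then
    ⟨WithLp.toLp 2 fun _ => 1, by
      rw [mem_sphere_zero_iff_norm, EuclideanSpace.norm_eq]
      simp⟩
  else
    ⟨(Real.sqrt N / euclideanNorm x) • WithLp.toLp 2 x, by
      have h' : ‖WithLp.toLp 2 x‖ ≠ 0 := by simpa using h
      rw [mem_sphere_zero_iff_norm, norm_smul, norm_div, Real.norm_eq_abs, Real.norm_eq_abs,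
        abs_of_nonneg (Real.sqrt_nonneg _), euclideanNorm, abs_norm, div_mul_cancel₀ _ h']⟩

theorem coe_radial_of_ne_zero {N : ℕ} {x : Fin N → ℝ} (hx : x ≠ 0) :
    (radial N x : EuclideanSpace ℝ (Fin N)) = (Real.sqrt N / euclideanNorm x) • WithLp.toLp 2 x := by
  rw [radial, dif_neg hx]

theorem radial_apply_of_ne_zero {N : ℕ} {x : Fin N → ℝ} (hx : x ≠ 0) (i : Fin N) :
    (radial N x : EuclideanSpace ℝ (Fin N)) i = Real.sqrt N / euclideanNorm x * x i := by
  rw [coe_radial_of_ne_zero hx]; simp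

theorem euclideanNorm_eq_sqrt {N : ℕ} (x : Fin N → ℝ) : euclideanNorm x = Real.sqrt (∑ i, x i ^ 2) := by
  rw [euclideanNorm, EuclideanSpace.norm_eq]; simp

@[fun_prop]
theorem measurable_euclideanNorm {N : ℕ} : Measurable (euclideanNorm (N := N)) := by
  unfold euclideanNorm; fun_prop

theorem measurable_radial (N : ℕ) : Measurable (radial N) := by
  refine (MeasurableEmbedding.subtype_coe
    Metric.isClosed_sphere.measurableSet).measurable_comp_iff.1 ?_
  have h : ((↑) : KacSphere N → EuclideanSpace ℝ (Fin N)) ∘ radial N = fun x =>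
      if x = 0 then WithLp.toLp 2 fun _ => 1 else (Real.sqrt N / euclideanNorm x) • WithLp.toLp 2 x := by
    ext1 x
    by_cases hx : x = 0 <;> simp [radial, hx]
  rw [h]
  exact Measurable.ite (measurableSet_singleton 0) measurable_const (by fun_prop)

/-- The point assigned to the origin has equal coordinates, so equivariance holds everywhere, even
if the origin has positive mass. -/
theorem permute_radial {N : ℕ} (π : Equiv.Perm (Fin N)) (x : Fin N → ℝ) :
    permute π (radial N x) = radial N (fun i => x (π.symm i)) := by
  apply Subtype.ext
  by_cases hx : x = 0
  · subst hx
    have h : (fun i => (0 : Fin N → ℝ) (π.symm i)) = 0 := rfl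
    rw [h]
    ext i
    simp [permute, radial]
  · have hx' : (fun i => x (π.symm i)) ≠ 0 := fun h => hx <| by
      ext i
      simpa using congrFun h (π i)
    have hn : euclideanNorm (fun i => x (π.symm i)) = euclideanNorm x := by
      rw [euclideanNorm_eq_sqrt, euclideanNorm_eq_sqrt, Equiv.sum_comp π.symm fun i => x i ^ 2]
    rw [coe_radial_of_ne_zero hx', hn]
    ext i
    simp [permute, coe_radial_of_ne_zero hx]

end Radial

/-! ### Polar coordinates for the Gaussian measure -/

theorem lintegral_pi_prod {α : Type*} [MeasurableSpace α] (μ : Measure α) [SigmaFinite μ] {n : ℕ}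
    {f : Fin n → α → ℝ≥0∞} (hf : ∀ i, Measurable (f i)) :
    ∫⁻ x, ∏ i, f i (x i) ∂(Measure.pi fun _ : Fin n => μ) = ∏ i, ∫⁻ a, f i a ∂μ := by
  induction n with
  | zero => simp
  | succ n ih =>
    rw [← ((measurePreserving_piFinSuccAbove (fun _ : Fin (n + 1) => μ) 0).symm).lintegral_comp
      (by fun_prop)]
    simp_rw [Fin.prod_univ_succ]
    rw [← ih (fun i => hf i.succ)]
    rw [← lintegral_prod_mul (hf 0).aemeasurable (Measurable.aemeasurable (by fun_prop))]
    rfl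

theorem pi_withDensity_eq {α : Type*} [MeasurableSpace α] (μ : Measure α) [SigmaFinite μ]
    {ρ : α → ℝ≥0∞} (hρ : Measurable ρ) [SigmaFinite (μ.withDensity ρ)] (n : ℕ) :
    (Measure.pi fun _ : Fin n => μ.withDensity ρ)
      = (Measure.pi fun _ : Fin n => μ).withDensity fun x => ∏ i, ρ (x i) := by
  refine Measure.pi_eq fun s hs => ?_
  rw [withDensity_apply _ (MeasurableSet.univ_pi hs), ← lintegral_indicator (MeasurableSet.univ_pi hs)]
  have h : ∀ x : Fin n → α, (Set.univ.pi s).indicator (fun x => ∏ i, ρ (x i)) x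
      = ∏ i, (s i).indicator ρ (x i) := by
    intro x
    by_cases hx : x ∈ Set.univ.pi s
    · rw [Set.indicator_of_mem hx]
      exact Finset.prod_congr rfl fun i _ => (Set.indicator_of_mem (hx i trivial) _).symm
    · rw [Set.indicator_of_notMem hx]
      simp only [Set.mem_pi, Set.mem_univ, true_implies, not_forall] at hx
      obtain ⟨i, hi⟩ := hx
      exact (Finset.prod_eq_zero (Finset.mem_univ i) (Set.indicator_of_notMem hi _)).symm
  simp_rw [h]
  rw [lintegral_pi_prod μ fun i => hρ.indicator (hs i)]
  exact Finset.prod_congr rfl fun i _ => by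
    rw [withDensity_apply _ (hs i), lintegral_indicator (hs i)]

/-- The standard Gaussian measure on `ℝ^N`. -/
noncomputable def gaussianPi (N : ℕ) : Measure (Fin N → ℝ) := Measure.pi fun _ => gaussianReal 0 1

instance (N : ℕ) : IsProbabilityMeasure (gaussianPi N) := by
  unfold gaussianPi; infer_instance

/-- The density of the standard Gaussian measure on `ℝ^N`, as a function of the norm. -/
noncomputable def gaussianRadialDensity (N : ℕ) (r : ℝ) : ℝ≥0∞ :=
  ENNReal.ofReal ((√(2 * Real.pi))⁻¹ ^ N * Real.exp (-r ^ 2 / 2))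

/-- The product of the one-dimensional densities depends on the norm alone, which is what allows
polar coordinates to factor. -/
theorem gaussianPi_eq_withDensity (N : ℕ) :
    gaussianPi N = volume.withDensity fun x => gaussianRadialDensity N (euclideanNorm x) := by
  have hγ : gaussianReal 0 1 = volume.withDensity (gaussianPDF 0 1) :=
    gaussianReal_of_var_ne_zero 0 one_ne_zero
  have : SigmaFinite (volume.withDensity (gaussianPDF 0 1)) := by rw [← hγ]; infer_instance
  rw [gaussianPi, hγ, pi_withDensity_eq _ (measurable_gaussianPDF 0 1)]
  congr 1
  ext x
  simp only [gaussianPDF, gaussianRadialDensity]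
  rw [← ENNReal.ofReal_prod_of_nonneg fun i _ => gaussianPDFReal_nonneg 0 1 _]
  congr 1
  simp only [gaussianPDFReal, Finset.prod_mul_distrib, ← Real.exp_sum]
  rw [euclideanNorm_eq_sqrt, Real.sq_sqrt (Finset.sum_nonneg fun i _ => sq_nonneg _)]
  simp [← Finset.sum_div]

theorem lintegral_radial_mul_volume {N : ℕ} (hN : 0 < N) {F : KacSphere N → ℝ≥0∞}
    {G : ℝ → ℝ≥0∞} (hF : Measurable F) (hG : Measurable G) :
    ∫⁻ x, F (radial N x) * G (euclideanNorm x) = (∫⁻ θ, F (dilate N θ) ∂unitSurface N) *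
      ∫⁻ r, G r ∂(Measure.volumeIoiPow (N - 1)) := by
  have : Nonempty (Fin N) := ⟨⟨0, hN⟩⟩
  have hd : Measurable (dilate N) := by
    unfold dilate; fun_prop
  set E := EuclideanSpace ℝ (Fin N)
  calc ∫⁻ x, F (radial N x) * G (euclideanNorm x)
      = ∫⁻ x : E, F (radial N (WithLp.ofLp x)) * G ‖x‖ := by
        rw [← (PiLp.volume_preserving_toLp (Fin N)).lintegral_comp_emb
          (MeasurableEquiv.toLp 2 (Fin N → ℝ)).measurableEmbedding]
        rfl
    -- Polar coordinates live off the origin, which is a null set because `0 < N`.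
    _ = ∫⁻ x : ({0}ᶜ : Set E), F (radial N (WithLp.ofLp x.1)) * G ‖x.1‖ 
          ∂((volume : Measure E).comap Subtype.val) := by
        rw [lintegral_subtype_comap (measurableSet_singleton _).compl
          (fun x : E => F (radial N (WithLp.ofLp x)) * G ‖x‖), restrict_compl_singleton]
    _ = ∫⁻ p, F (dilate N p.1) * G p.2 ∂((unitSurface N).prod (Measure.volumeIoiPow (N - 1))) := by
        have h := (volume : Measure E).measurePreserving_homeomorphUnitSphereProd
        rw [show Module.finrank ℝ E = N by simp [E]] at h
        rw [unitSurface, ← h.lintegral_comp_emb (Homeomorph.measurableEmbedding _)]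
        refine lintegral_congr fun x => ?_
        refine congrArg₂ (· * ·) (congrArg F (Subtype.ext ?_))
          (congrArg G (homeomorphUnitSphereProd_apply_snd_coe E x).symm)
        have hx : WithLp.ofLp x.1 ≠ 0 := by
          have h2 : (x : E) ≠ 0 := x.2
          simpa using h2
        rw [coe_radial_of_ne_zero hx]
        simp [dilate, euclideanNorm, smul_smul, div_eq_mul_inv]
    _ = _ := by
        rw [lintegral_prod_mul (f := fun θ => F (dilate N θ)) (g := fun r : Set.Ioi (0 : ℝ) => G r)]
        · exact (hF.comp hd).aemeasurable
        · exact (hG.comp measurable_subtype_coe).aemeasurable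

/-- Under the standard Gaussian measure the direction is uniformly distributed and independent of
the norm. -/
theorem lintegral_radial_mul_gaussianPi {N : ℕ} (hN : 0 < N) {F : KacSphere N → ℝ≥0∞}
    {G : ℝ → ℝ≥0∞} (hF : Measurable F) (hG : Measurable G) :
    ∫⁻ x, F (radial N x) * G (euclideanNorm x) ∂(gaussianPi N)
      = (∫⁻ v, F v ∂(uniformMeasure N)) * ∫⁻ x, G (euclideanNorm x) ∂(gaussianPi N) := by
  have : Nonempty (Fin N) := ⟨⟨0, hN⟩⟩
  have hd : Measurable (dilate N) := by
    unfold dilate; fun_prop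
  have hg : Measurable (gaussianRadialDensity N) := by
    unfold gaussianRadialDensity; fun_prop
  have key : ∀ {F : KacSphere N → ℝ≥0∞} (_ : Measurable F),
      ∫⁻ x, F (radial N x) * G (euclideanNorm x) ∂(gaussianPi N)
        = (∫⁻ θ, F (dilate N θ) ∂unitSurface N) *
          ∫⁻ r, gaussianRadialDensity N r * G r ∂(Measure.volumeIoiPow (N - 1)) := by
    intro F hF
    have hFG : Measurable fun x : Fin N → ℝ => F (radial N x) * G (euclideanNorm x) :=
      (hF.comp (measurable_radial N)).mul (hG.comp measurable_euclideanNorm)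
    have hg' : Measurable fun x : Fin N → ℝ => gaussianRadialDensity N (euclideanNorm x) :=
      hg.comp measurable_euclideanNorm
    rw [gaussianPi_eq_withDensity, lintegral_withDensity_eq_lintegral_mul _ hg' hFG,
      ← lintegral_radial_mul_volume hN (G := fun r => gaussianRadialDensity N r * G r) hF
        (hg.mul hG)]
    refine lintegral_congr fun x => ?_
    simp only [Pi.mul_apply]
    ring
  -- Taking `F = 1` expresses the Gaussian integral of `G` through the radial integral, which
  -- therefore never has to be computed; only the surface mass is left to cancel.
  have h1 := key (F := fun _ => 1) measurable_const
  simp only [one_mul, lintegral_const] at h1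
  have hne : unitSurface N Set.univ ≠ 0 := by
    rw [unitSurface, Ne, Measure.measure_univ_eq_zero]
    exact Measure.toSphere_ne_zero _
  have hfin : unitSurface N Set.univ ≠ ∞ := by
    unfold unitSurface; exact measure_ne_top _ _
  rw [key hF, h1, uniformMeasure, lintegral_map hF hd, lintegral_smul_measure, smul_eq_mul,
    ← mul_assoc, mul_right_comm _ _ (unitSurface N Set.univ),
    ENNReal.inv_mul_cancel hne hfin, one_mul]

theorem map_radial_gaussianPi {N : ℕ} (hN : 0 < N) :
    (gaussianPi N).map (radial N) = uniformMeasure N := by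
  ext s hs
  have h := lintegral_radial_mul_gaussianPi hN (F := s.indicator 1) (G := 1)
    (measurable_one.indicator hs) measurable_one
  simp only [Pi.one_apply, mul_one, lintegral_const, measure_univ, lintegral_indicator_one hs] at h
  rw [← h, ← lintegral_indicator_one hs, lintegral_map (measurable_one.indicator hs)
    (measurable_radial N)]

theorem isProbabilityMeasure_uniformMeasure {N : ℕ} (hN : 0 < N) :
    IsProbabilityMeasure (uniformMeasure N) := by
  rw [← map_radial_gaussianPi hN]
  exact Measure.isProbabilityMeasure_map (measurable_radial N).aemeasurable

/-! ### Projected tensor products -/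

section Projected

variable (μ : Measure ℝ) [IsProbabilityMeasure μ]

/-- The law on the sphere of the radial projection of `N` independent variables of law `μ`. -/
noncomputable def projectedPi (μ : Measure ℝ) (N : ℕ) : Measure (KacSphere N) :=
  (Measure.pi fun _ : Fin N => μ).map (radial N)

instance (N : ℕ) : IsProbabilityMeasure (projectedPi μ N) :=
  Measure.isProbabilityMeasure_map (measurable_radial N).aemeasurable

/-- The law of an infinite sequence of independent variables of law `μ`. -/
noncomputable abbrev iidMeasure (μ : Measure ℝ) : Measure (ℕ → ℝ) :=
  Measure.infinitePi fun _ : ℕ => μ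

/-- Realizes all the product laws on one probability space, so that almost sure limits in `N` make
sense. -/
theorem map_coords_iidMeasure (N : ℕ) :
    (iidMeasure μ).map (fun ω (i : Fin N) => ω i) = Measure.pi fun _ : Fin N => μ := by
  rw [Measure.map_infinitePi_infinitePi_of_inj (P := fun _ : ℕ => μ) Fin.val_injective,
    Measure.infinitePi_eq_pi]

theorem map_pi_perm {N : ℕ} (π : Equiv.Perm (Fin N)) :
    (Measure.pi fun _ : Fin N => μ).map (fun x i => x (π i)) = Measure.pi fun _ : Fin N => μ := by
  rw [← Measure.infinitePi_eq_pi,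
    Measure.map_infinitePi_infinitePi_of_inj (P := fun _ : Fin N => μ) π.injective]

theorem measurable_permute {N : ℕ} (π : Equiv.Perm (Fin N)) : Measurable (permute π) :=
  Measurable.subtype_mk
    ((LinearIsometryEquiv.continuous _).measurable.comp measurable_subtype_coe)

theorem map_permute_projectedPi {N : ℕ} (π : Equiv.Perm (Fin N)) :
    (projectedPi μ N).map (permute π) = projectedPi μ N := by
  rw [projectedPi, Measure.map_map (measurable_permute π) (measurable_radial N)]
  have h : permute π ∘ radial N = radial N ∘ fun x i => x (π.symm i) :=
    funext fun x => permute_radial π x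
  rw [h, ← Measure.map_map (measurable_radial N) (by fun_prop), map_pi_perm μ π.symm]

/-- The law of large numbers for the norm. -/
theorem tendsto_sqrt_div_euclideanNorm (hint : Integrable (fun v => v ^ 2) μ) (hμ : ∫ v, v ^ 2 ∂μ = 1) :
    ∀ᵐ ω ∂(iidMeasure μ),
      Tendsto (fun N : ℕ => Real.sqrt N / euclideanNorm fun i : Fin N => ω i) atTop (𝓝 1) := by
  have hmp : ∀ i, MeasurePreserving (fun ω : ℕ → ℝ => ω i) (iidMeasure μ) μ := fun i =>
    measurePreserving_eval_infinitePi (fun _ : ℕ => μ) i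
  have hsq : Measurable fun v : ℝ => v ^ 2 := by fun_prop
  have hm : ∀ i, Measurable fun ω : ℕ → ℝ => ω i ^ 2 := fun i => by fun_prop
  have h := strong_law_ae_real (μ := iidMeasure μ) (fun i ω => ω i ^ 2)
    ((hmp 0).integrable_comp_of_integrable hint)
    (fun i j hij => (iIndepFun_infinitePi (P := fun _ : ℕ => μ) (X := fun _ v => v ^ 2)
      fun _ => hsq).indepFun hij)
    (fun i => by
      refine ⟨(hm i).aemeasurable, (hm 0).aemeasurable, ?_⟩
      have h' : ∀ i, (iidMeasure μ).map (fun ω => ω i ^ 2) = μ.map fun v => v ^ 2 := fun i => by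
        conv_rhs => rw [← (hmp i).map_eq]
        rw [Measure.map_map hsq (measurable_pi_apply i)]
        rfl
      rw [h' i, h' 0])
  have hE : ∫ ω : ℕ → ℝ, ω 0 ^ 2 ∂(iidMeasure μ) = 1 := by
    rw [← hμ]
    conv_rhs => rw [← (hmp 0).map_eq]
    rw [integral_map (measurable_pi_apply 0).aemeasurable hsq.aestronglyMeasurable]
  filter_upwards [h] with ω hω
  rw [hE] at hω
  have h1 := (hω.inv₀ one_ne_zero).sqrt
  rw [inv_one, Real.sqrt_one] at h1
  refine h1.congr fun N => ?_
  rw [euclideanNorm_eq_sqrt, inv_div, Real.sqrt_div N.cast_nonneg, Finset.sum_range fun i => ω i ^ 2]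

theorem measurable_firstCoords (k N : ℕ) : Measurable (firstCoords k N) := by
  refine measurable_pi_lambda _ fun i => ?_
  unfold firstCoords
  by_cases h : (i : ℕ) < N
  · simp only [h, dif_pos]; fun_prop
  · simp only [h, dif_neg, not_false_iff]; fun_prop

theorem tendsto_integral_marginal_projectedPi (hint : Integrable (fun v => v ^ 2) μ)
    (hμ : ∫ v, v ^ 2 ∂μ = 1) (k : ℕ) (χ : (Fin k → ℝ) →ᵇ ℝ) :
    Tendsto (fun N : ℕ => ∫ v, χ v ∂(marginal k (projectedPi μ N))) atTop
      (𝓝 (∫ v, χ v ∂(Measure.pi fun _ : Fin k => μ))) := by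
  have hm : ∀ N, Measurable fun (ω : ℕ → ℝ) =>
      firstCoords k N (radial N fun i : Fin N => ω i) := fun N =>
    (measurable_firstCoords k N).comp ((measurable_radial N).comp (by fun_prop))
  have h1 : ∀ N, ∫ v, χ v ∂(marginal k (projectedPi μ N))
      = ∫ ω, χ (firstCoords k N (radial N fun i : Fin N => ω i)) ∂(iidMeasure μ) := fun N => by
    rw [marginal, projectedPi, ← map_coords_iidMeasure,
      Measure.map_map (measurable_radial N) (by fun_prop),
      Measure.map_map (measurable_firstCoords k N)
        ((measurable_radial N).comp (by fun_prop)),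
      integral_map ((measurable_firstCoords k N).comp
        ((measurable_radial N).comp (by fun_prop))).aemeasurable
        χ.continuous.aestronglyMeasurable]
    rfl
  have h2 : ∫ v, χ v ∂(Measure.pi fun _ : Fin k => μ)
      = ∫ ω, χ (fun i : Fin k => ω i) ∂(iidMeasure μ) := by
    rw [← map_coords_iidMeasure,
      integral_map (Measurable.aemeasurable (by fun_prop)) χ.continuous.aestronglyMeasurable]
  simp_rw [h1, h2]
  refine tendsto_integral_of_dominated_convergence (fun _ => ‖χ‖)
    (fun N => (χ.continuous.measurable.comp (hm N)).aestronglyMeasurable) (integrable_const _)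
    (fun N => Eventually.of_forall fun ω => χ.norm_coe_le_norm _) ?_
  filter_upwards [tendsto_sqrt_div_euclideanNorm μ hint hμ] with ω hω
  refine (χ.continuous.tendsto _).comp (tendsto_pi_nhds.2 fun i => ?_)
  have h3 := hω.mul_const (ω i)
  rw [one_mul] at h3
  refine h3.congr' ?_
  -- At the zero vector the ratio is 0 by the convention for division by zero; having limit 1, it is
  -- eventually nonzero and the vector is too.
  filter_upwards [hω.eventually_ne one_ne_zero, eventually_ge_atTop k] with N hN hk
  have hx : (fun i : Fin N => ω i) ≠ 0 := by
    intro h0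
    rw [h0] at hN
    simp [euclideanNorm] at hN
  rw [firstCoords, dif_pos (i.2.trans_le hk), radial_apply_of_ne_zero hx]

end Projected

/-! ### Exponential moments on the sphere -/

theorem exists_dilation_uniform {φ : ℝ → ℝ} (hφ : Continuous φ) (hc : HasCompactSupport φ) {ε : ℝ}
    (hε : 0 < ε) : ∃ δ, 0 < δ ∧ δ < 1 ∧ ∀ t, |t - 1| ≤ δ → ∀ v, φ (t * v) ≤ φ v + ε := by
  obtain ⟨η, hη, hφη⟩ := Metric.uniformContinuous_iff.1 (hc.uniformContinuous_of_continuous hφ) ε hε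
  obtain ⟨R, hR⟩ := hc.isBounded.subset_closedBall 0
  have hzero : ∀ v, R < |v| → φ v = 0 := fun v hv => image_eq_zero_of_notMem_tsupport fun h => by
    have := hR h
    rw [mem_closedBall_zero_iff, Real.norm_eq_abs] at this
    linarith
  set R' := max R 1
  have hR' : 0 < R' := lt_max_of_lt_right one_pos
  -- For `|v| ≤ 2R'` the dilation moves `v` by at most `η/2`. For `|v| > 2R'`, `|t| ≥ 1/2` keeps
  -- both `v` and `t v` outside the support.
  refine ⟨min (1 / 2) (η / (4 * R')), by positivity, (min_le_left _ _).trans_lt (by norm_num),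
    fun t ht v => ?_⟩
  have ht1 := ht.trans (min_le_left _ _)
  have ht2 := ht.trans (min_le_right _ _)
  rcases le_or_gt |v| (2 * R') with hv | hv
  · have hd : dist (t * v) v < η := by
      rw [Real.dist_eq, show t * v - v = (t - 1) * v by ring, abs_mul]
      calc |t - 1| * |v| ≤ η / (4 * R') * (2 * R') := by gcongr
        _ = η / 2 := by field_simp; norm_num
        _ < η := by linarith
    have := (abs_lt.1 (Real.dist_eq _ _ ▸ hφη hd)).2
    linarith
  · have h1 : 1 / 2 ≤ |t| := by
      rw [abs_le] at ht1
      exact le_trans (by linarith [ht1.1]) (le_abs_self t)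
    have h2 : R < |t * v| := by
      rw [abs_mul]
      calc R ≤ R' := le_max_left _ _
        _ = 1 / 2 * (2 * R') := by ring
        _ < 1 / 2 * |v| := by gcongr
        _ ≤ |t| * |v| := by gcongr
    rw [hzero _ h2, hzero v ((le_max_left R 1).trans_lt (by linarith))]
    linarith

theorem integral_sq_gaussianReal : ∫ v, v ^ 2 ∂(gaussianReal 0 1) = 1 := by
  have h := variance_id_gaussianReal (μ := 0) (v := 1)
  rw [variance_eq_integral (by fun_prop)] at h
  simpa [integral_id_gaussianReal] using h

theorem integrable_sq_gaussianReal : Integrable (fun v => v ^ 2) (gaussianReal 0 1) :=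
  (memLp_id_gaussianReal 2).integrable_sq

/-- The law of large numbers in probability. Any positive constant could replace `1/2`: it
disappears after taking logarithms and dividing by `N`. -/
theorem eventually_half_le_gaussianPi {δ : ℝ} (hδ : 0 < δ) :
    ∀ᶠ N : ℕ in atTop, 1 / 2 ≤ gaussianPi N {x | |Real.sqrt N / euclideanNorm x - 1| ≤ δ} := by
  have hm : ∀ N : ℕ, Measurable fun ω : ℕ → ℝ => Real.sqrt N / euclideanNorm fun i : Fin N => ω i :=
    fun N => measurable_const.div (measurable_euclideanNorm.comp (by fun_prop))
  have h := tendstoInMeasure_of_tendsto_ae (μ := iidMeasure (gaussianReal 0 1))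
    (fun N => (hm N).aestronglyMeasurable)
    (tendsto_sqrt_div_euclideanNorm _ integrable_sq_gaussianReal integral_sq_gaussianReal)
  rw [tendstoInMeasure_iff_norm] at h
  have hhalf : (0 : ℝ≥0∞) < 1 / 2 := by simp
  filter_upwards [(h δ hδ).eventually_lt_const hhalf] with N hN
  have hs : MeasurableSet {x : Fin N → ℝ | |Real.sqrt N / euclideanNorm x - 1| ≤ δ} :=
    measurableSet_le (by fun_prop) measurable_const
  rw [gaussianPi, ← map_coords_iidMeasure, Measure.map_apply (by fun_prop) hs]
  set A := (fun (ω : ℕ → ℝ) (i : Fin N) => ω i) ⁻¹' {x | |Real.sqrt N / euclideanNorm x - 1| ≤ δ}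
  have hA : iidMeasure (gaussianReal 0 1) Aᶜ ≤ 1 / 2 := by
    refine (measure_mono fun ω hω => ?_).trans hN.le
    exact (not_le.1 (show ¬ |Real.sqrt N / (euclideanNorm fun i : Fin N => ω i) - 1| ≤ δ from hω)).le
  have hA1 := measure_univ_le_add_compl (μ := iidMeasure (gaussianReal 0 1)) A
  rw [measure_univ] at hA1
  have h2 : (1 : ℝ≥0∞) / 2 + 1 / 2 = 1 := ENNReal.add_halves 1
  have h3 : (1 : ℝ≥0∞) / 2 + 1 / 2 ≤ iidMeasure (gaussianReal 0 1) A + 1 / 2 :=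
    h2.le.trans (hA1.trans (by gcongr))
  exact (ENNReal.add_le_add_iff_right (by simp)).1 h3

/-- By independence of direction and norm, the integral times the probability that `|√N/|x| - 1| ≤
δ` is a Gaussian integral over that event. There each `φ` grows by at most `ε` under projection, and
the resulting product integrates to an `N`-th power. The factor 2 inverts the probability bound. -/
theorem eventually_integral_exp_sum_uniformMeasure_le {φ : ℝ → ℝ} (hφ : Continuous φ)
    (hc : HasCompactSupport φ) {ε : ℝ} (hε : 0 < ε) :
    ∀ᶠ N : ℕ in atTop,
      ∫ v, Real.exp (∑ i, φ ((v : EuclideanSpace ℝ (Fin N)) i)) ∂(uniformMeasure N)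
        ≤ 2 * (Real.exp ε * ∫ v, Real.exp (φ v) ∂(gaussianReal 0 1)) ^ N := by
  obtain ⟨δ, hδ, hδ1, hφδ⟩ := exists_dilation_uniform hφ hc hε
  obtain ⟨M, hM⟩ := hc.exists_bound_of_continuous hφ
  have hintγ : Integrable (fun v => Real.exp (φ v)) (gaussianReal 0 1) :=
    Integrable.of_bound (by fun_prop) (Real.exp M) (Eventually.of_forall fun x => by
      rw [Real.norm_eq_abs, Real.abs_exp]
      exact Real.exp_le_exp.2 ((le_abs_self _).trans (hM x)))
  set Z := ∫ v, Real.exp (φ v) ∂(gaussianReal 0 1)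
  have hZ : 0 ≤ Z := integral_nonneg fun v => (Real.exp_pos _).le
  filter_upwards [eventually_half_le_gaussianPi hδ, eventually_gt_atTop 0] with N hN hN0
  set F : KacSphere N → ℝ≥0∞ := fun v =>
    ENNReal.ofReal (Real.exp (∑ i, φ ((v : EuclideanSpace ℝ (Fin N)) i)))
  set s : Set ℝ := {r | |Real.sqrt N / r - 1| ≤ δ}
  have hs : MeasurableSet s := measurableSet_le (by fun_prop) measurable_const
  have hFm : Measurable F := by fun_prop
  have h1 := lintegral_radial_mul_gaussianPi hN0 hFm
    (measurable_const (a := (1 : ℝ≥0∞)).indicator hs)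
  have h2 : ∫⁻ x : Fin N → ℝ, s.indicator (fun _ => (1 : ℝ≥0∞)) (euclideanNorm x) ∂(gaussianPi N)
      = gaussianPi N {x | |Real.sqrt N / euclideanNorm x - 1| ≤ δ} := by
    exact lintegral_indicator_one (measurable_euclideanNorm hs)
  have h3 : ∀ x : Fin N → ℝ, F (radial N x) * s.indicator (fun _ => (1 : ℝ≥0∞)) (euclideanNorm x)
      ≤ ∏ i, ENNReal.ofReal (Real.exp ε * Real.exp (φ (x i))) := by
    intro x
    by_cases hx : euclideanNorm x ∈ s
    -- At the origin the ratio is 0 by convention, at distance `1 > δ` from 1.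
    · have hx0 : x ≠ 0 := by
        rintro rfl
        have : |(0 : ℝ) - 1| ≤ δ := by simpa [s, euclideanNorm] using hx
        rw [zero_sub, abs_neg, abs_one] at this
        linarith
      rw [Set.indicator_of_mem hx, mul_one,
        ← ENNReal.ofReal_prod_of_nonneg fun i _ => by positivity]
      apply ENNReal.ofReal_le_ofReal
      simp only [← Real.exp_add, ← Real.exp_sum]
      apply Real.exp_le_exp.2
      refine Finset.sum_le_sum fun i _ => ?_
      rw [radial_apply_of_ne_zero hx0, add_comm]
      exact hφδ _ hx _
    · rw [Set.indicator_of_notMem hx, mul_zero]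
      exact zero_le
  have h4 : ∫⁻ x : Fin N → ℝ, ∏ i, ENNReal.ofReal (Real.exp ε * Real.exp (φ (x i))) ∂(gaussianPi N)
      = ENNReal.ofReal ((Real.exp ε * Z) ^ N) := by
    rw [gaussianPi, lintegral_pi_prod (f := fun _ v => ENNReal.ofReal (Real.exp ε * Real.exp (φ v)))
      _ fun _ => by fun_prop]
    rw [← ofReal_integral_eq_lintegral_ofReal (hintγ.const_mul _)
      (Eventually.of_forall fun v => by positivity), integral_const_mul, Finset.prod_const,
      Finset.card_univ, Fintype.card_fin, ENNReal.ofReal_pow (by positivity)]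
  have h5 := (lintegral_mono h3).trans_eq h4
  rw [h1, h2] at h5
  have h6 : (∫⁻ v, F v ∂(uniformMeasure N)) ≤ 2 * ENNReal.ofReal ((Real.exp ε * Z) ^ N) := by
    calc (∫⁻ v, F v ∂(uniformMeasure N))
        = 2 * ((∫⁻ v, F v ∂(uniformMeasure N)) * (1 / 2)) := by
          rw [mul_comm, mul_assoc, one_div, ENNReal.inv_mul_cancel (by simp) (by simp), mul_one]
      _ ≤ _ := by
          gcongr
          exact le_trans (by gcongr) h5
  rw [integral_eq_lintegral_of_nonneg_ae (Eventually.of_forall fun v => (Real.exp_pos _).le)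
    (by fun_prop)]
  refine ENNReal.toReal_le_of_le_ofReal (by positivity) ?_
  rwa [ENNReal.ofReal_mul (by norm_num), ENNReal.ofReal_ofNat]

/-! ### Convergence of the entropy -/

section Limit

variable (μ : Measure ℝ) [IsProbabilityMeasure μ]

theorem klDiv_projectedPi_le {N : ℕ} (hN : 0 < N) :
    klDiv (projectedPi μ N) (uniformMeasure N) ≤ N * klDiv μ (gaussianReal 0 1) := by
  rw [← map_radial_gaussianPi hN]
  exact (klDiv_map_le _ _ (measurable_radial N)).trans (klDiv_pi_le _ _ N)

/-- By symmetry, a transposition carries each coordinate to the first one. -/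
theorem integral_sum_projectedPi {φ : ℝ → ℝ} (hφ : Continuous φ) (hc : HasCompactSupport φ)
    {N : ℕ} (hN : 0 < N) :
    ∫ v, ∑ i, φ ((v : EuclideanSpace ℝ (Fin N)) i) ∂(projectedPi μ N)
      = N * ∫ x, φ (x 0) ∂(marginal 1 (projectedPi μ N)) := by
  obtain ⟨M, hM⟩ := hc.exists_bound_of_continuous hφ
  have hm : ∀ i, AEStronglyMeasurable
      (fun v : KacSphere N => φ ((v : EuclideanSpace ℝ (Fin N)) i)) (projectedPi μ N) :=
    fun i => by fun_prop
  have h : ∀ i, ∫ v, φ ((v : EuclideanSpace ℝ (Fin N)) i) ∂(projectedPi μ N)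
      = ∫ x, φ (x 0) ∂(marginal 1 (projectedPi μ N)) := fun i => by
    have hφ0 : Continuous fun x : Fin 1 → ℝ => φ (x 0) := by fun_prop
    rw [marginal, integral_map (measurable_firstCoords 1 N).aemeasurable
      hφ0.aestronglyMeasurable]
    simp only [firstCoords, Fin.val_zero, hN, dif_pos]
    conv_lhs => rw [← map_permute_projectedPi μ (Equiv.swap (⟨0, hN⟩ : Fin N) i)]
    rw [integral_map (measurable_permute _).aemeasurable (by fun_prop)]
    simp [permute]
  rw [integral_finsetSum _ fun i _ => Integrable.of_bound (hm i) M
    (Eventually.of_forall fun v => hM _)]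
  simp [h]

theorem tendsto_klDiv_projectedPi (hint : Integrable (fun v => v ^ 2) μ)
    (hμ : ∫ v, v ^ 2 ∂μ = 1) (h : klDiv μ (gaussianReal 0 1) ≠ ∞) :
    Tendsto (fun N : ℕ => klDiv (projectedPi μ N) (uniformMeasure N) / (N : ℝ≥0∞)) atTop
      (𝓝 (klDiv μ (gaussianReal 0 1))) := by
  refine tendsto_order.2 ⟨fun c hc => ?_, fun c hc => ?_⟩
  · have hc' : c.toReal < (klDiv μ (gaussianReal 0 1)).toReal :=
      (ENNReal.toReal_lt_toReal hc.ne_top h).2 hc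
    obtain ⟨φ, hφ, hφc, hL⟩ := exists_hasCompactSupport_lt_integral_sub_log μ _ h hc'
    obtain ⟨M, hM⟩ := hφc.exists_bound_of_continuous hφ
    set Z := ∫ v, Real.exp (φ v) ∂(gaussianReal 0 1)
    have hZ : 0 < Z := integral_exp_pos <|
      Integrable.of_bound (by fun_prop) (Real.exp M) (Eventually.of_forall fun x => by
        rw [Real.norm_eq_abs, Real.abs_exp]
        exact Real.exp_le_exp.2 ((le_abs_self _).trans (hM x)))
    set L := ∫ v, φ v ∂μ - Real.log Z
    -- Three losses of `ε` per particle occur: the marginal convergence, the factor `e^ε`, and `log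
    -- 2 ≤ N ε`. A quarter of the gap leaves `L - 3ε > c`.
    set ε := (L - c.toReal) / 4
    have hε : 0 < ε := by simp only [ε]; linarith
    have hmarg : Tendsto (fun N : ℕ => ∫ x, φ (x 0) ∂(marginal 1 (projectedPi μ N))) atTop
        (𝓝 (∫ v, φ v ∂μ)) := by
      have h1 := tendsto_integral_marginal_projectedPi μ hint hμ 1
        (BoundedContinuousFunction.ofNormedAddCommGroup (fun x : Fin 1 → ℝ => φ (x 0))
          (by fun_prop) M fun x => hM _)
      have h2 : ∫ x : Fin 1 → ℝ, φ (x 0) ∂(Measure.pi fun _ : Fin 1 => μ) = ∫ v, φ v ∂μ := by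
        have h3 := (measurePreserving_eval (fun _ : Fin 1 => μ) 0).map_eq
        conv_rhs => rw [← h3]
        rw [integral_map (measurable_pi_apply 0).aemeasurable hφ.aestronglyMeasurable]
      rw [← h2]
      exact h1
    have hlog : ∀ᶠ N : ℕ in atTop, Real.log 2 ≤ N * ε :=
      (tendsto_natCast_atTop_atTop.atTop_mul_const hε).eventually_ge_atTop _
    filter_upwards [hmarg.eventually_const_lt (sub_lt_self _ hε), hlog,
      eventually_integral_exp_sum_uniformMeasure_le hφ hφc hε, eventually_gt_atTop 0]
      with N hN1 hN2 hN3 hN0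
    have := isProbabilityMeasure_uniformMeasure hN0
    set Φ : KacSphere N → ℝ := fun v => ∑ i, φ ((v : EuclideanSpace ℝ (Fin N)) i)
    have hΦm : Measurable Φ := by fun_prop
    have hΦb : ∀ v, |Φ v| ≤ N * M := fun v => by
      refine (Finset.abs_sum_le_sum_abs _ _).trans ((Finset.sum_le_sum fun i _ => hM _).trans ?_)
      simp
    have hΦe : Integrable (fun v => Real.exp (Φ v)) (uniformMeasure N) :=
      Integrable.of_bound hΦm.exp.aestronglyMeasurable (Real.exp (N * M))
        (Eventually.of_forall fun v => by
          rw [Real.norm_eq_abs, Real.abs_exp]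
          exact Real.exp_le_exp.2 ((le_abs_self _).trans (hΦb v)))
    have hDV := integral_sub_log_integral_exp_le_klDiv (projectedPi μ N) (uniformMeasure N)
      (Integrable.of_bound hΦm.aestronglyMeasurable (N * M) (Eventually.of_forall hΦb)) hΦe
    rw [integral_sum_projectedPi μ hφ hφc hN0] at hDV
    have hlogle := Real.log_le_log (integral_exp_pos hΦe) hN3
    rw [Real.log_mul (by norm_num) (by positivity), Real.log_pow,
      Real.log_mul (Real.exp_pos _).ne' hZ.ne', Real.log_exp] at hlogle
    have hNpos : (0 : ℝ) < N := Nat.cast_pos.2 hN0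
    have hcL : c.toReal < L - 3 * ε := by simp only [ε]; linarith
    have hkey : N * (L - 3 * ε) ≤ N * ∫ x, φ (x 0) ∂(marginal 1 (projectedPi μ N))
        - Real.log (∫ v, Real.exp (Φ v) ∂(uniformMeasure N)) := by
      have := mul_lt_mul_of_pos_left hN1 hNpos
      simp only [L]
      nlinarith
    calc c = ENNReal.ofReal c.toReal := (ENNReal.ofReal_toReal hc.ne_top).symm
      _ < ENNReal.ofReal (L - 3 * ε) :=
          (ENNReal.ofReal_lt_ofReal_iff (ENNReal.toReal_nonneg.trans_lt hcL)).2 hcL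
      _ ≤ _ := by
          rw [ENNReal.le_div_iff_mul_le (by simp [hN0.ne']) (by simp), mul_comm,
            ← ENNReal.ofReal_natCast, ← ENNReal.ofReal_mul hNpos.le]
          exact (ENNReal.ofReal_le_ofReal hkey).trans hDV
  · filter_upwards [eventually_gt_atTop 0] with N hN
    refine lt_of_le_of_lt ?_ hc
    refine ENNReal.div_le_of_le_mul ?_
    rw [mul_comm]
    exact klDiv_projectedPi_le μ hN

theorem isEntropicallyChaotic_projectedPi (hint : Integrable (fun v => v ^ 2) μ)
    (hμ : ∫ v, v ^ 2 ∂μ = 1) (h : klDiv μ (gaussianReal 0 1) ≠ ∞) :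
    IsEntropicallyChaotic μ (projectedPi μ) where
  isProbabilityMeasure _ _ := inferInstance
  symmetric _ _ π := map_permute_projectedPi μ π
  tendsto_marginal k _ χ := tendsto_integral_marginal_projectedPi μ hint hμ k χ
  tendsto_entropy := tendsto_klDiv_projectedPi μ hint hμ h

end Limit

end KacChaos

/-! ### From the measure back to its density. -/

theorem mainTheorem3 (f : ℝ → ℝ)
    (hf_nonneg : ∀ v, 0 ≤ f v)
    (hf_integrable : Integrable f)
    (hf_mass : ∫ v, f v = 1)
    (hf_moment_integrable : Integrable (fun v => f v * v ^ 2))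
    (hf_moment : ∫ v, f v * v ^ 2 = 1)
    (hf_entropy : InformationTheory.klDiv (KacChaos.densityMeasure f)
      (ProbabilityTheory.gaussianReal 0 1) < ⊤) :
    ∃ μN : (N : ℕ) → Measure (KacChaos.KacSphere N),
      KacChaos.IsEntropicallyChaotic (KacChaos.densityMeasure f) μN := by
  have hprob : IsProbabilityMeasure (KacChaos.densityMeasure f) := ⟨by
    rw [KacChaos.densityMeasure, withDensity_apply _ MeasurableSet.univ, Measure.restrict_univ,
      ← ofReal_integral_eq_lintegral_ofReal hf_integrable (Eventually.of_forall hf_nonneg),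
      hf_mass, ENNReal.ofReal_one]⟩
  have hfm : AEMeasurable (fun v => ENNReal.ofReal (f v)) := hf_integrable.aemeasurable.ennreal_ofReal
  have hfin : ∀ᵐ v, ENNReal.ofReal (f v) < ⊤ := Eventually.of_forall fun v => ENNReal.ofReal_lt_top
  have heq : ∀ v, (ENNReal.ofReal (f v)).toReal • v ^ 2 = f v * v ^ 2 := fun v => by
    rw [ENNReal.toReal_ofReal (hf_nonneg v), smul_eq_mul]
  refine ⟨_, KacChaos.isEntropicallyChaotic_projectedPi (KacChaos.densityMeasure f) ?_ ?_
    hf_entropy.ne⟩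
  · rw [KacChaos.densityMeasure, integrable_withDensity_iff_integrable_smul₀' hfm hfin]
    simpa only [heq] using hf_moment_integrable
  · rw [KacChaos.densityMeasure, integral_withDensity_eq_integral_toReal_smul₀ hfm hfin]
    simpa only [heq] using hf_moment
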